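/- Let $X$ be a complex Fréchet space, i.e. a complete metrizable locally convex space over $\mathbb{C}$. Let $L(X)$ be the space of continuous linear operators on $X$, and let $L_b(X)$ be $L(X)$ with the topology of uniform convergence on bounded subsets of $X$. An operator $B\in L(X)$ is called *bounded in the sense of Allan*, written $B\in L_b(X)_0$, if there is $\mu\in\mathbb{C}\setminus\{0\}$ such that $\{(\mu B)^n : n\in\mathbb{N}_0\}$ is bounded in $L_b(X)$. For a linear operator $A\colon D(A)\to X$ on a linear subspace $D(A)\subseteq X$, the resolvent set $\rho(A)\subseteq\overline{\mathbb{C}}=\mathbb{C}\cup\{\infty\}$ consists of all $\lambda\in\mathbb{C}$ for which $\lambda-A\colon D(A)\to X$ is bijective with $(\lambda-A)^{-1}\in L_b(X)_0$, together with the point $\infty$ if $A\in L_b(X)_0$. Put $\sigma(A)=\overline{\mathbb{C}}\setminus\rho(A)$ and $s(A)=\sup\{\operatorname{Re}\lambda : \lambda\in\sigma(A)\cap\mathbb{C}\}\in[-\infty,\infty]$. For $B\in L(X)$ put $r(B)=\sup\{|\lambda| : \lambda\in\sigma(B)\}\in[0,\infty]$, where $|\infty|=\infty$. (Suprema of the empty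 set are taken in $[-\infty,\infty]$ and in $[0,\infty]$ respectively, and $\log 0=-\infty$, $\log\infty=\infty$; the empty case is only relevant for $X=\{0\}$.) Let $(T(t))_{t\ge 0}$ be a $C_0$-semigroup on $X$, i.e. $T(t)\in L(X)$, $T(0)=\mathrm{id}_X$, $T(t+s)=T(t)T(s)$ for all $t,s\ge0$, and $t\mapsto T(t)x$ is continuous on $[0,\infty)$ for every $x\in X$. Assume that it is exponentially equicontinuous: there is $\omega\in\mathbb{R}$ such that for every continuous seminorm $q$ on $X$ there are a continuous seminorm $p$ on $X$ and $M\ge1$ with $q(T(t)x)\le Me^{\omega t}p(x)$ for all $t\ge0$, $x\in X$. Let $A$ be its generator, i.e. $Ax=\lim_{t\searrow0}\frac{T(t)x-x}{t}$ with $D(A)$ the set of all $x\in X$ for which this limit exists. Assume that $D(A)=X$, that $A\in L(X)$, and that $\{A^n : n\in\mathbb{N}_0\}$ is equicontinuous. Then $$s(A)=\log r(T(1)).$$ -/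

import Mathlib

open scoped NNReal ENNReal Topology
open Filter

noncomputable section

namespace FrechetSemigroup

set_option linter.unusedSectionVars false

variable {X : Type*} [AddCommGroup X] [Module ℂ X] [UniformSpace X] [IsUniformAddGroup X]
  [ContinuousSMul ℂ X]

/-- A family `(T(t))_{t ≥ 0}` of continuous linear operators is a `C₀`-semigroup: `T(0) = id`,
`T(t + s) = T(t) T(s)`, and all orbits `t ↦ T(t) x` are continuous on `[0, ∞)`. -/
structure IsC0Semigroup (T : ℝ≥0 → X →L[ℂ] X) : Prop where
  map_zero : T 0 = ContinuousLinearMap.id ℂ X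
  map_add : ∀ t s : ℝ≥0, T (t + s) = (T t).comp (T s)
  continuous_orbit : ∀ x : X, Continuous fun t : ℝ≥0 => T t x

/-- Exponential equicontinuity of order `ω`, with respect to the fundamental system of all
continuous seminorms. -/
def IsExpEquicontinuousOfOrder (T : ℝ≥0 → X →L[ℂ] X) (ω : ℝ) : Prop :=
  ∀ q : Seminorm ℂ X, Continuous q → ∃ p : Seminorm ℂ X, Continuous p ∧ ∃ M : ℝ, 1 ≤ M ∧
    ∀ (t : ℝ≥0) (x : X), q (T t x) ≤ M * Real.exp (ω * t) * p x

/-- Exponential equicontinuity: exponential equicontinuity of some real order. -/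
def IsExpEquicontinuous (T : ℝ≥0 → X →L[ℂ] X) : Prop :=
  ∃ ω : ℝ, IsExpEquicontinuousOfOrder T ω

/-- `(T(t) x - x) / t → y` as `t ↘ 0`. -/
def HasGeneratorValue (T : ℝ≥0 → X →L[ℂ] X) (x y : X) : Prop :=
  Tendsto (fun t : ℝ≥0 => ((t : ℝ) : ℂ)⁻¹ • (T t x - x)) (𝓝[>] 0) (𝓝 y)

theorem HasGeneratorValue.add {T : ℝ≥0 → X →L[ℂ] X} {x y x' y' : X}
    (h : HasGeneratorValue T x y) (h' : HasGeneratorValue T x' y') :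
    HasGeneratorValue T (x + x') (y + y') := by
  refine (Tendsto.add h h').congr fun t => ?_
  rw [← smul_add, map_add]
  congr 1
  abel

theorem HasGeneratorValue.smul {T : ℝ≥0 → X →L[ℂ] X} {x y : X} (c : ℂ)
    (h : HasGeneratorValue T x y) : HasGeneratorValue T (c • x) (c • y) := by
  refine (Tendsto.const_smul h c).congr fun t => ?_
  rw [map_smul, ← smul_sub, smul_comm]

theorem HasGeneratorValue.zero (T : ℝ≥0 → X →L[ℂ] X) : HasGeneratorValue T 0 0 := by
  simpa [HasGeneratorValue] using tendsto_const_nhds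

theorem HasGeneratorValue.unique [T2Space X] {T : ℝ≥0 → X →L[ℂ] X} {x y y' : X}
    (h : HasGeneratorValue T x y) (h' : HasGeneratorValue T x y') : y = y' :=
  tendsto_nhds_unique h h'

/-- The generator `(A, D(A))` of `(T(t))_{t ≥ 0}`: its domain is the set of all `x` for which
`lim_{t ↘ 0} (T(t) x - x) / t` exists, and `A x` is this limit. -/
def generator [T2Space X] (T : ℝ≥0 → X →L[ℂ] X) : X →ₗ.[ℂ] X where
  domain :=
    { carrier := {x | ∃ y, HasGeneratorValue T x y}
      add_mem' := fun ⟨_, h⟩ ⟨_, h'⟩ => ⟨_, h.add h'⟩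
      zero_mem' := ⟨0, HasGeneratorValue.zero T⟩
      smul_mem' := fun c _ ⟨_, h⟩ => ⟨_, h.smul c⟩ }
  toFun :=
    { toFun := fun x => x.2.choose
      map_add' := fun x x' =>
        (x + x').2.choose_spec.unique (x.2.choose_spec.add x'.2.choose_spec)
      map_smul' := fun c x => (c • x).2.choose_spec.unique (x.2.choose_spec.smul c) }

/-- A continuous operator `S ∈ L(X)`, regarded as an operator with domain `X`. -/
def ofContinuous (S : X →L[ℂ] X) : X →ₗ.[ℂ] X := (S : X →ₗ[ℂ] X).toPMap ⊤

/-- The elements of `L_b(X)₀`: those `B` for which `{(μ B)ⁿ : n ≥ 0}` is bounded in `L_b(X)` for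
some `μ ≠ 0`. Mathlib's topology on `X →L[ℂ] X` is that of uniform convergence on the bounded
subsets of `X`. -/
def IsAllanBounded (B : X →L[ℂ] X) : Prop :=
  ∃ μ : ℂ, μ ≠ 0 ∧ Bornology.IsVonNBounded ℂ (Set.range fun n : ℕ => (μ • B) ^ n)

/-- The finite part of the resolvent set: `z - A : D(A) → X` is bijective and its inverse
belongs to `L_b(X)₀`. -/
def IsRegularPoint (A : X →ₗ.[ℂ] X) (z : ℂ) : Prop :=
  Function.Bijective (fun x : A.domain => z • (x : X) - A x) ∧
    ∃ R : X →L[ℂ] X, (∀ x : A.domain, R (z • (x : X) - A x) = x) ∧ IsAllanBounded R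

/-- The resolvent set in the extended complex plane; it contains `∞` exactly if
`A ∈ L_b(X)₀`. -/
def allanResolventSet (A : X →ₗ.[ℂ] X) : Set (OnePoint ℂ) :=
  (fun z : ℂ => (z : OnePoint ℂ)) '' {z | IsRegularPoint A z} ∪
    {w | w = OnePoint.infty ∧ ∃ S : X →L[ℂ] X, A = ofContinuous S ∧ IsAllanBounded S}

/-- The spectrum, as a subset of the extended complex plane. -/
def allanSpectrum (A : X →ₗ.[ℂ] X) : Set (OnePoint ℂ) := (allanResolventSet A)ᶜ

/-- The spectral bound `s(A) = sup {Re z : z ∈ σ(A) ∩ ℂ}`, in `[-∞, ∞]`. -/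
def spectralBound (A : X →ₗ.[ℂ] X) : EReal :=
  ⨆ (z : ℂ) (_ : (z : OnePoint ℂ) ∈ allanSpectrum A), (z.re : EReal)

/-- The modulus on the extended complex plane, with `|∞| = ∞`. -/
def extendedModulus (w : OnePoint ℂ) : ℝ≥0∞ := w.elim ∞ fun z => ENNReal.ofReal ‖z‖

/-- The spectral radius `r(B) = sup {|w| : w ∈ σ(B)}` of `B ∈ L(X)`, in `[0, ∞]`. -/
def allanSpectralRadius (B : X →L[ℂ] X) : ℝ≥0∞ :=
  ⨆ w ∈ allanSpectrum (ofContinuous B), extendedModulus w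

end FrechetSemigroup

end

/-!
The statement is a spectral mapping theorem, `σ(T(1)) ∩ ℂ = e^(σ(A) ∩ ℂ)`, read off for suprema:
`log |e^z| = Re z`.

Since the powers of `A` are equicontinuous, `∑ aₙ Aⁿ` converges for every absolutely summable
sequence `a` (`exists_isSeriesOf`). This gives a multiplicative functional calculus for functions
holomorphic near the closed unit disc (`IsSeriesOf.mul_taylorCoeff`), all of whose values are
bounded in the sense of Allan (`IsSeriesOf.isAllanBounded`). By the Banach–Steinhaus theorem, Allan
boundedness of `B` means equicontinuity of the powers of some nonzero multiple of `B`, so products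
of commuting Allan bounded operators are Allan bounded (`IsAllanBounded.mul`).

The operator `T(1)` is the value of `exp` in this calculus (`isSeriesOf_exp`): the functions
`t ↦ f(T(t) Aⁿ x)` have right derivatives `t ↦ f(T(t) Aⁿ⁺¹ x)` and are bounded on `[0, 1]` uniformly
in `n`, so the remainder in Taylor's formula tends to zero.

For the two inclusions write `e^z - e^w = (z - w) g(w)` with `g` entire, so that
`e^z - T(1) = (z - A) g(A)`. If `e^z - T(1)` has an Allan bounded inverse `R`, then `R g(A)` is an
Allan bounded inverse of `z - A` (`IsRegularPoint.of_exp`). Conversely, suppose that all `z` with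
`e^z = c` are regular for `A` (`IsRegularPoint.exp`). The closed unit disc has diameter less than
`2π`, so it contains at most one such `z`. If there is none, `w ↦ 1 / (c - e^w)` is holomorphic near
the disc, and its value at `A` inverts `c - T(1)`. If there is one, `g` has no zero in the disc,
hence `g(A)` is invertible, and so is `c - T(1) = (z - A) g(A)`. The point `∞` does not belong to
`σ(T(1))`, because `T(1)` is itself Allan bounded.
-/

namespace FrechetSemigroup

/-! ### Equicontinuity in terms of seminorms, and Allan boundedness -/

/-- A family of operators is *seminorm bounded* if each continuous seminorm of its values is
dominated, uniformly over the family, by one continuous seminorm of the argument. This is the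
seminorm form of equicontinuity. -/
def SeminormBounded {X ι : Type*} [AddCommGroup X] [Module ℂ X] [TopologicalSpace X]
    (S : ι → X →L[ℂ] X) : Prop :=
  ∀ q : Seminorm ℂ X, Continuous q → ∃ p : Seminorm ℂ X, Continuous p ∧ ∀ i x, q (S i x) ≤ p x

theorem _root_.HasSum.seminorm_le {X ι : Type*} [AddCommGroup X] [Module ℂ X] [TopologicalSpace X]
    {f : ι → X} {x : X} (hf : HasSum f x) {q : Seminorm ℂ X} (hq : Continuous q)
    {g : ι → ℝ} {c : ℝ} (hg : HasSum g c) (hfg : ∀ i, q (f i) ≤ g i) : q x ≤ c := by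
  refine le_of_tendsto_of_tendsto ((hq.tendsto x).comp hf) hg (.of_forall fun s => ?_)
  exact (Finset.le_sum_of_subadditive q (map_zero q).le (map_add_le_add q) s f).trans
    (Finset.sum_le_sum fun i _ => hfg i)

/-- In a complete locally convex space, absolute convergence with respect to every continuous
seminorm implies convergence. -/
theorem summable_of_summable_seminorm {X ι : Type*} [AddCommGroup X] [Module ℂ X] [UniformSpace X]
    [IsUniformAddGroup X] [PolynormableSpace ℂ X] [CompleteSpace X] {f : ι → X}
    (h : ∀ q : Seminorm ℂ X, Continuous q → Summable fun i => q (f i)) : Summable f := by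
  rw [summable_iff_vanishing]
  intro e he
  obtain ⟨⟨s, r⟩, hr, hs⟩ := (PolynormableSpace.withSeminorms ℂ X).hasBasis_zero_ball.mem_iff.1 he
  set q : Seminorm ℂ X := s.sup fun p : {p : Seminorm ℂ X // Continuous p} => p.1
  have hqc : Continuous q := Seminorm.continuous_finsetSup fun p _ => p.2
  obtain ⟨t, ht⟩ := summable_iff_vanishing.1 (h q hqc) (Metric.ball 0 r) (Metric.ball_mem_nhds _ hr)
  refine ⟨t, fun u hu => hs ?_⟩
  rw [Seminorm.mem_ball_zero]
  have h1 := ht u hu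
  rw [mem_ball_zero_iff, Real.norm_eq_abs] at h1
  exact (Finset.le_sum_of_subadditive q (map_zero q).le (map_add_le_add q) u f).trans_lt
    ((le_abs_self _).trans_lt h1)

open scoped ComplexOrder in
/-- Real convexity and complex convexity agree, the nonnegative complex numbers being the
nonnegative reals; so the topology of a complex locally convex space is given by complex
seminorms. -/
theorem polynormableSpace_of_locallyConvexSpace_real {X : Type*} [AddCommGroup X] [Module ℂ X]
    [TopologicalSpace X] [IsTopologicalAddGroup X] [ContinuousSMul ℂ X] [LocallyConvexSpace ℝ X] :
    PolynormableSpace ℂ X := by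
  have : ContinuousSMul ℝ X := IsScalarTower.continuousSMul ℂ
  have : LocallyConvexSpace ℂ X := by
    refine ⟨fun x => (LocallyConvexSpace.convex_basis (𝕜 := ℝ) x).to_hasBasis
      (fun s hs => ⟨s, ⟨hs.1, ?_⟩, subset_rfl⟩) fun s hs => ⟨s, ⟨hs.1, hs.2.lift ℝ⟩, subset_rfl⟩⟩
    exact convex_of_nonneg_surjective_algebraMap _
      (fun _ => (RCLike.nonneg_iff_exists_ofReal (K := ℂ)).mp) hs.2
  exact (with_gaugeSeminormFamily (𝕜 := ℂ) (E := X)).toPolynormableSpace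

section Bounded

variable {X : Type*} [AddCommGroup X] [Module ℂ X] [UniformSpace X] [IsUniformAddGroup X]
  [ContinuousSMul ℂ X] [PolynormableSpace ℂ X]

theorem equicontinuous_iff_seminormBounded {ι : Type*} {S : ι → X →L[ℂ] X} :
    Equicontinuous (fun i x => S i x) ↔ SeminormBounded S := by
  have h := ((PolynormableSpace.withSeminorms ℂ X).equicontinuous_TFAE
    (fun i => (S i : X →ₗ[ℂ] X))).out 1 3
  refine Iff.trans h ⟨fun H q hq => H ⟨q, hq⟩, fun H q => H q.1 q.2⟩

theorem SeminormBounded.isVonNBounded {ι : Type*} {S : ι → X →L[ℂ] X} (hS : SeminormBounded S) :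
    Bornology.IsVonNBounded ℂ (Set.range S) := by
  have hw := PolynormableSpace.withSeminorms ℂ X
  rw [ContinuousLinearMap.isVonNBounded_iff (𝕜₁ := ℂ)]
  intro s hs
  rw [hw.isVonNBounded_iff_seminorm_bounded]
  intro q
  obtain ⟨p, hp, hle⟩ := hS q.1 q.2
  obtain ⟨r, hr, hb⟩ := hw.isVonNBounded_iff_seminorm_bounded.1 hs ⟨p, hp⟩
  refine ⟨r, hr, ?_⟩
  rintro _ ⟨_, ⟨i, rfl⟩, x, hx, rfl⟩
  exact (hle i x).trans_lt (hb x hx)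

theorem SeminormBounded.of_isVonNBounded [BarrelledSpace ℂ X] {ι : Type*} {S : ι → X →L[ℂ] X}
    (hS : Bornology.IsVonNBounded ℂ (Set.range S)) : SeminormBounded S := by
  rw [← equicontinuous_iff_seminormBounded]
  refine UniformEquicontinuous.equicontinuous
    (PolynormableSpace.banach_steinhaus (𝕜₁ := ℂ) (𝕜₂ := ℂ) fun x => ?_)
  refine (ContinuousLinearMap.isVonNBounded_image2_apply hS
    (Bornology.isVonNBounded_singleton (𝕜 := ℂ) x)).subset ?_
  rintro _ ⟨i, rfl⟩
  exact ⟨S i, ⟨i, rfl⟩, x, rfl, rfl⟩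

/-- By the Banach–Steinhaus theorem, boundedness of the powers in `L_b(X)` is the same as
equicontinuity. -/
theorem isAllanBounded_iff_seminormBounded [BarrelledSpace ℂ X] {B : X →L[ℂ] X} :
    IsAllanBounded B ↔ ∃ μ : ℂ, μ ≠ 0 ∧ SeminormBounded fun n : ℕ => (μ • B) ^ n :=
  ⟨fun ⟨μ, h0, h⟩ => ⟨μ, h0, .of_isVonNBounded h⟩, fun ⟨μ, h0, h⟩ => ⟨μ, h0, h.isVonNBounded⟩⟩

theorem IsAllanBounded.mul [BarrelledSpace ℂ X] {B C : X →L[ℂ] X} (hB : IsAllanBounded B)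
    (hC : IsAllanBounded C) (hBC : Commute B C) : IsAllanBounded (B * C) := by
  rw [isAllanBounded_iff_seminormBounded] at *
  obtain ⟨μ, hμ, hB⟩ := hB
  obtain ⟨ν, hν, hC⟩ := hC
  refine ⟨μ * ν, mul_ne_zero hμ hν, fun q hq => ?_⟩
  obtain ⟨p, hp, hpq⟩ := hB q hq
  obtain ⟨r, hr, hrp⟩ := hC p hp
  refine ⟨r, hr, fun n x => ?_⟩
  have h : ((μ * ν) • (B * C)) ^ n = (μ • B) ^ n * (ν • C) ^ n := by
    rw [← ((hBC.smul_left μ).smul_right ν).mul_pow, smul_mul_smul_comm]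
  simp only [h]
  exact (hpq n _).trans (hrp n x)

end Bounded

/-! ### Absolutely summable power series in an operator with equicontinuous powers -/

/-- `S = ∑ aₙ Aⁿ`, with pointwise convergence. -/
def IsSeriesOf {X : Type*} [AddCommGroup X] [Module ℂ X] [TopologicalSpace X]
    [IsTopologicalAddGroup X] [ContinuousConstSMul ℂ X]
    (A : X →L[ℂ] X) (a : ℕ → ℂ) (S : X →L[ℂ] X) : Prop :=
  ∀ x, HasSum (fun n => a n • (A ^ n) x) (S x)

section Series

variable {X : Type*} [AddCommGroup X] [Module ℂ X] [UniformSpace X] [IsUniformAddGroup X]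
  [ContinuousSMul ℂ X] {A : X →L[ℂ] X} {a b : ℕ → ℂ} {S R : X →L[ℂ] X}

theorem IsSeriesOf.unique [T2Space X] (hS : IsSeriesOf A a S) (hR : IsSeriesOf A a R) : S = R :=
  ContinuousLinearMap.ext fun x => (hS x).unique (hR x)

theorem IsSeriesOf.commute [T2Space X] (hS : IsSeriesOf A a S) (hR : Commute R A) :
    Commute R S := by
  refine ContinuousLinearMap.ext fun x => ?_
  refine (R.hasSum (hS x)).unique ((hS (R x)).congr_fun fun n => ?_)
  rw [map_smul]
  exact congrArg (a n • ·) (congrArg (fun B : X →L[ℂ] X => B x) (hR.pow_right n).eq)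

theorem IsSeriesOf.one (A : X →L[ℂ] X) : IsSeriesOf A (fun n => if n = 0 then 1 else 0) 1 := by
  intro x
  have h := hasSum_single (f := fun n : ℕ => (if n = 0 then (1 : ℂ) else 0) • (A ^ n) x) 0
    (fun n hn => by simp [hn])
  simpa using! h

theorem IsSeriesOf.self (A : X →L[ℂ] X) : IsSeriesOf A (fun n => if n = 1 then 1 else 0) A := by
  intro x
  have h := hasSum_single (f := fun n : ℕ => (if n = 1 then (1 : ℂ) else 0) • (A ^ n) x) 1
    (fun n hn => by simp [hn])
  simpa using! h

theorem IsSeriesOf.const_sub (hS : IsSeriesOf A a S) (c : ℂ) :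
    IsSeriesOf A (fun n => (if n = 0 then c else 0) - a n) (c • 1 - S) := by
  intro x
  refine (((IsSeriesOf.one A x).const_smul c).sub (hS x)).congr_fun fun n => ?_
  rw [sub_smul, smul_smul, mul_ite, mul_one, mul_zero]

variable [PolynormableSpace ℂ X]

theorem exists_isSeriesOf [T2Space X] [CompleteSpace X] (hA : SeminormBounded fun n : ℕ => A ^ n)
    (ha : Summable fun n => ‖a n‖) : ∃ S, IsSeriesOf A a S := by
  have hsum (x : X) : Summable fun n => a n • (A ^ n) x := by
    refine summable_of_summable_seminorm fun q hq => ?_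
    obtain ⟨p, -, hp⟩ := hA q hq
    refine Summable.of_nonneg_of_le (fun n => apply_nonneg q _) (fun n => ?_) (ha.mul_right (p x))
    rw [map_smul_eq_mul]
    exact mul_le_mul_of_nonneg_left (hp n x) (norm_nonneg _)
  let S : X →ₗ[ℂ] X :=
    { toFun := fun x => ∑' n, a n • (A ^ n) x
      map_add' := fun x y => by
        simp only [map_add, smul_add]
        exact (hsum x).tsum_add (hsum y)
      map_smul' := fun c x => by
        simp only [map_smul, RingHom.id_apply]
        rw [← (hsum x).tsum_const_smul c]
        exact tsum_congr fun n => smul_comm _ _ _ }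
  have hS : Continuous S := by
    have hw := PolynormableSpace.withSeminorms ℂ X
    refine hw.continuous_of_continuous_comp S fun q => ?_
    obtain ⟨p, hpc, hp⟩ := hA q.1 q.2
    have hc : 0 ≤ ∑' n, ‖a n‖ := tsum_nonneg fun n => norm_nonneg _
    refine Seminorm.continuous_of_le (q := (∑' n, ‖a n‖).toNNReal • p) ?_ fun x => ?_
    · exact hpc.const_smul (∑' n, ‖a n‖).toNNReal
    · rw [smul_apply, NNReal.smul_def, Real.coe_toNNReal _ hc]
      refine (hsum x).hasSum.seminorm_le q.2 (ha.hasSum.mul_right (p x)) fun n => ?_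
      rw [map_smul_eq_mul]
      exact mul_le_mul_of_nonneg_left (hp n x) (norm_nonneg _)
  exact ⟨⟨S, hS⟩, fun x => (hsum x).hasSum⟩

/-- The powers of `∑ aₙ Aⁿ`, rescaled by `∑ |aₙ| + 1`, are dominated by the same seminorm as
the powers of `A`. -/
theorem IsSeriesOf.isAllanBounded [BarrelledSpace ℂ X] (hS : IsSeriesOf A a S)
    (hA : SeminormBounded fun n : ℕ => A ^ n) (ha : Summable fun n => ‖a n‖) :
    IsAllanBounded S := by
  -- The summand `1` keeps the scaling factor nonzero when all coefficients vanish.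
  set c : ℝ := (∑' n, ‖a n‖) + 1 with hc
  have hc0 : 0 < c := by
    have : 0 ≤ ∑' n, ‖a n‖ := tsum_nonneg fun n => norm_nonneg _
    positivity
  rw [isAllanBounded_iff_seminormBounded]
  refine ⟨(c : ℂ)⁻¹, inv_ne_zero (by exact_mod_cast hc0.ne'), fun q hq => ?_⟩
  obtain ⟨p, hpc, hp⟩ := hA q hq
  have key (k : ℕ) : ∀ (m : ℕ) (x : X), q ((A ^ m) ((S ^ k) x)) ≤ c ^ k * p x := by
    induction k with
    | zero => simpa using hp
    | succ k ih =>
      intro m x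
      have h1 : HasSum (fun n => a n • (A ^ (m + n)) ((S ^ k) x)) ((A ^ m) ((S ^ (k + 1)) x)) := by
        have h2 := (A ^ m).hasSum (hS ((S ^ k) x))
        rw [pow_succ']
        refine h2.congr_fun fun n => ?_
        rw [map_smul, pow_add]
        rfl
      refine (h1.seminorm_le hq (ha.hasSum.mul_right (c ^ k * p x)) fun n => ?_).trans ?_
      · rw [map_smul_eq_mul]
        exact mul_le_mul_of_nonneg_left (ih _ x) (norm_nonneg _)
      · rw [pow_succ', mul_assoc]
        have : 0 ≤ c ^ k * p x := mul_nonneg (pow_nonneg hc0.le _) (apply_nonneg p x)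
        exact mul_le_mul_of_nonneg_right (by rw [hc]; linarith) this
  refine ⟨p, hpc, fun n x => ?_⟩
  have h1 := key n 0 x
  simp only [pow_zero, one_apply_eq_self] at h1
  change q ((((c : ℂ)⁻¹ • S) ^ n) x) ≤ p x
  rw [smul_pow, smul_apply, map_smul_eq_mul, norm_pow, norm_inv,
    Complex.norm_real, Real.norm_of_nonneg hc0.le, inv_pow, inv_mul_le_iff₀ (pow_pos hc0 n)]
  exact h1

/-- Cauchy products of coefficient sequences correspond to products of operators. -/
theorem IsSeriesOf.mul [T2Space X] [CompleteSpace X] (hS : IsSeriesOf A a S) (hR : IsSeriesOf A b R)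
    (hA : SeminormBounded fun n : ℕ => A ^ n)
    (ha : Summable fun n => ‖a n‖) (hb : Summable fun n => ‖b n‖) :
    IsSeriesOf A (fun n => ∑ k ∈ Finset.HasAntidiagonal.antidiagonal n, a k.1 * b k.2) (S * R) := by
  intro x
  have hsum : Summable fun k : ℕ × ℕ => (a k.1 * b k.2) • (A ^ (k.1 + k.2)) x := by
    refine summable_of_summable_seminorm fun q hq => ?_
    obtain ⟨p, -, hp⟩ := hA q hq
    refine Summable.of_nonneg_of_le (fun n => apply_nonneg q _) (fun n => ?_)
      ((ha.mul_of_nonneg hb (fun _ => norm_nonneg _) fun _ => norm_nonneg _).mul_right (p x))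
    rw [map_smul_eq_mul, norm_mul]
    exact mul_le_mul_of_nonneg_left (hp _ x) (by positivity)
  have h1 : HasSum (fun k : ℕ × ℕ => (a k.1 * b k.2) • (A ^ (k.1 + k.2)) x) ((S * R) x) := by
    have h2 := hsum.hasSum
    have h3 (n : ℕ) : HasSum (fun m => (a n * b m) • (A ^ (n + m)) x) (a n • (A ^ n) (R x)) := by
      refine ((a n • A ^ n).hasSum (hR x)).congr_fun fun m => ?_
      rw [map_smul, smul_apply, smul_smul, pow_add, mul_comm]
      rfl
    rwa [(h2.prod_fiberwise h3).unique (hS (R x))] at h2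
  have h4 := (Finset.HasAntidiagonal.sigmaAntidiagonalEquivProd (A := ℕ)).hasSum_iff.2 h1
  refine (h4.sigma fun n => hasSum_fintype _).congr_fun fun n => ?_
  rw [Finset.sum_smul, ← Finset.sum_coe_sort]
  refine Finset.sum_congr rfl fun k _ => ?_
  simp [Finset.HasAntidiagonal.mem_antidiagonal.1 k.2]

end Series

/-! ### Taylor coefficients -/

/-- The `n`-th Taylor coefficient of `F` at the origin. -/
noncomputable def taylorCoeff (F : ℂ → ℂ) (n : ℕ) : ℂ := (n.factorial : ℂ)⁻¹ * iteratedDeriv n F 0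

/-- A function holomorphic on a neighbourhood of the closed unit disc is holomorphic on a larger
disc, by compactness, so its Taylor series converges absolutely at `1`. -/
theorem summable_norm_taylorCoeff {F : ℂ → ℂ} (hF : AnalyticOnNhd ℂ F (Metric.closedBall 0 1)) :
    Summable fun n => ‖taylorCoeff F n‖ := by
  obtain ⟨δ, hδ, hsub⟩ := (isCompact_closedBall (0 : ℂ) 1).exists_thickening_subset_open
    (isOpen_analyticAt ℂ F) hF
  rw [thickening_closedBall hδ zero_le_one] at hsub
  have hd : DifferentiableOn ℂ F (Metric.ball 0 (δ + 1)) := fun z hz =>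
    (hsub hz).differentiableAt.differentiableWithinAt
  have h1 : (1 : ℂ) ∈ Metric.ball (0 : ℂ) (δ + 1) := by simpa using hδ
  refine summable_norm_iff.2 ((Complex.hasSum_taylorSeries_on_ball hd h1).summable.congr
    fun n => ?_)
  simp [taylorCoeff]

theorem taylorCoeff_mul {F G : ℂ → ℂ} (hF : AnalyticAt ℂ F 0) (hG : AnalyticAt ℂ G 0) :
    taylorCoeff (fun w => F w * G w) = fun n => ∑ k ∈ Finset.HasAntidiagonal.antidiagonal n,
      taylorCoeff F k.1 * taylorCoeff G k.2 := by
  funext n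
  simp only [taylorCoeff, iteratedDeriv_fun_mul hF.contDiffAt hG.contDiffAt, Finset.mul_sum,
    Finset.Nat.sum_antidiagonal_eq_sum_range_succ_mk, Nat.succ_eq_add_one]
  refine Finset.sum_congr rfl fun i hi ↦ ?_
  rw [Nat.cast_choose _ (by grind)]
  field_simp [Nat.factorial_ne_zero]

theorem taylorCoeff_const_sub {F : ℂ → ℂ} (hF : AnalyticAt ℂ F 0) (c : ℂ) :
    taylorCoeff (fun w => c - F w) = fun n => (if n = 0 then c else 0) - taylorCoeff F n := by
  funext n
  rw [taylorCoeff, iteratedDeriv_fun_sub contDiffAt_const hF.contDiffAt, iteratedDeriv_const,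
    taylorCoeff]
  split_ifs with h <;> simp [h]

theorem taylorCoeff_one : taylorCoeff (fun _ => 1) = fun n => if n = 0 then 1 else 0 := by
  funext n
  rw [taylorCoeff, iteratedDeriv_const]
  split_ifs with h <;> simp [h]

theorem taylorCoeff_id : taylorCoeff (fun w => w) = fun n => if n = 1 then 1 else 0 := by
  funext n
  rw [taylorCoeff, iteratedDeriv_fun_id_zero]
  split_ifs with h <;> simp [h]

theorem taylorCoeff_exp : taylorCoeff Complex.exp = fun n => (n.factorial : ℂ)⁻¹ := by
  funext n
  simp [taylorCoeff, iteratedDeriv_eq_iterate]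

/-! ### The functional calculus and the spectral mapping theorem for the exponential -/

section Regular

variable {X : Type*} [AddCommGroup X] [Module ℂ X] [UniformSpace X] [IsUniformAddGroup X]
  [ContinuousSMul ℂ X]

/-- For an everywhere defined operator, regularity of `z` is two-sided invertibility of `z - B` in
the algebra `L(X)`, with Allan bounded inverse. -/
theorem isRegularPoint_ofContinuous_iff {B : X →L[ℂ] X} {z : ℂ} :
    IsRegularPoint (ofContinuous B) z ↔
      ∃ R : X →L[ℂ] X, R * (z • 1 - B) = 1 ∧ (z • 1 - B) * R = 1 ∧ IsAllanBounded R := by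
  constructor
  · rintro ⟨hb, R, hR, hA⟩
    have h1 : R * (z • 1 - B) = 1 := ContinuousLinearMap.ext fun x => hR ⟨x, trivial⟩
    refine ⟨R, h1, ContinuousLinearMap.ext fun y => ?_, hA⟩
    obtain ⟨x, rfl⟩ := hb.2 y
    exact congrArg (z • 1 - B : X →L[ℂ] X) (hR x)
  · rintro ⟨R, h1, h2, hA⟩
    have h3 (x : X) : R (z • x - B x) = x := congrArg (fun S : X →L[ℂ] X => S x) h1
    refine ⟨⟨fun x y hxy => ?_, fun y => ⟨⟨R y, trivial⟩, ?_⟩⟩, R, fun x => h3 x, hA⟩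
    · exact Subtype.ext ((h3 x).symm.trans ((congrArg R hxy).trans (h3 y)))
    · exact congrArg (fun S : X →L[ℂ] X => S y) h2

theorem coe_mem_allanSpectrum_iff {A : X →ₗ.[ℂ] X} {z : ℂ} :
    (z : OnePoint ℂ) ∈ allanSpectrum A ↔ ¬ IsRegularPoint A z := by
  simp [allanSpectrum, allanResolventSet]

theorem infty_notMem_allanSpectrum {B : X →L[ℂ] X} (hB : IsAllanBounded B) :
    OnePoint.infty ∉ allanSpectrum (ofContinuous B) := fun h => h (.inr ⟨rfl, B, rfl, hB⟩)

variable [PolynormableSpace ℂ X] [T2Space X] [CompleteSpace X]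
  {A : X →L[ℂ] X}

/-- The holomorphic functional calculus is multiplicative. -/
theorem IsSeriesOf.mul_taylorCoeff {F G : ℂ → ℂ} {S R : X →L[ℂ] X}
    (hS : IsSeriesOf A (taylorCoeff F) S) (hR : IsSeriesOf A (taylorCoeff G) R)
    (hA : SeminormBounded fun n : ℕ => A ^ n)
    (hF : AnalyticOnNhd ℂ F (Metric.closedBall 0 1))
    (hG : AnalyticOnNhd ℂ G (Metric.closedBall 0 1)) :
    IsSeriesOf A (taylorCoeff fun w => F w * G w) (S * R) := by
  have h0 : (0 : ℂ) ∈ Metric.closedBall (0 : ℂ) 1 := by simp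
  rw [taylorCoeff_mul (hF 0 h0) (hG 0 h0)]
  exact hS.mul hR hA (summable_norm_taylorCoeff hF) (summable_norm_taylorCoeff hG)

/-- A holomorphic function of `A` without zeros on the closed unit disc has an Allan bounded
inverse, the same function of `A` formed with the reciprocal. -/
theorem exists_inverse_of_ne_zero [BarrelledSpace ℂ X] {F : ℂ → ℂ} {S : X →L[ℂ] X}
    (hA : SeminormBounded fun n : ℕ => A ^ n)
    (hF : AnalyticOnNhd ℂ F (Metric.closedBall 0 1))
    (h0 : ∀ z ∈ Metric.closedBall (0 : ℂ) 1, F z ≠ 0) (hS : IsSeriesOf A (taylorCoeff F) S) :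
    ∃ R, IsSeriesOf A (taylorCoeff F⁻¹) R ∧ R * S = 1 ∧ S * R = 1 ∧ IsAllanBounded R := by
  have hG : AnalyticOnNhd ℂ F⁻¹ (Metric.closedBall 0 1) := hF.inv h0
  obtain ⟨R, hR⟩ := exists_isSeriesOf hA (summable_norm_taylorCoeff hG)
  have hRS : R * S = 1 := by
    have h1 := hR.mul_taylorCoeff hS hA hG hF
    have h2 : taylorCoeff (fun w => F⁻¹ w * F w) = taylorCoeff (fun _ => 1) := by
      funext n
      have : (fun w => F⁻¹ w * F w) =ᶠ[𝓝 0] fun _ => 1 := by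
        filter_upwards [Metric.closedBall_mem_nhds (0 : ℂ) one_pos] with w hw
        exact inv_mul_cancel₀ (h0 w hw)
      rw [taylorCoeff, this.iteratedDeriv_eq n, taylorCoeff]
    rw [h2, taylorCoeff_one] at h1
    exact h1.unique (IsSeriesOf.one A)
  have hcomm : Commute S R := hR.commute (hS.commute (Commute.refl A)).symm
  exact ⟨R, hR, hRS, hcomm.eq.trans hRS,
    hR.isAllanBounded hA (summable_norm_taylorCoeff hG)⟩

/-- The quotient `g(w) = (e^w - e^z) / (w - z)` is entire; `dslope` has the derivative `e^z` as its
value at `w = z`, which removes the singularity. -/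
theorem analyticOnNhd_dslope_exp (z : ℂ) (s : Set ℂ) :
    AnalyticOnNhd ℂ (dslope Complex.exp z) s := by
  have h : DifferentiableOn ℂ (dslope Complex.exp z) Set.univ :=
    (Complex.differentiableOn_dslope univ_mem).2 Complex.differentiable_exp.differentiableOn
  exact (h.analyticOnNhd isOpen_univ).mono (Set.subset_univ s)

/-- The functional calculus turns `e^z - e^w = (z - w) g(w)` into a factorization of
`e^z - e^A`. -/
theorem exp_smul_sub_eq_mul {E G : X →L[ℂ] X} {z : ℂ}
    (hA : SeminormBounded fun n : ℕ => A ^ n)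
    (hE : IsSeriesOf A (taylorCoeff Complex.exp) E)
    (hG : IsSeriesOf A (taylorCoeff (dslope Complex.exp z)) G) :
    Complex.exp z • 1 - E = (z • 1 - A) * G := by
  have h1 := hE.const_sub (Complex.exp z)
  rw [← taylorCoeff_const_sub (Complex.differentiable_exp.analyticAt 0)] at h1
  have hid : IsSeriesOf A (taylorCoeff fun w => w) A := taylorCoeff_id ▸ IsSeriesOf.self A
  have h2 := hid.const_sub z
  rw [← taylorCoeff_const_sub (F := fun w => w) analyticAt_id] at h2
  have h3 := h2.mul_taylorCoeff hG hA (fun w _ => analyticAt_const.sub analyticAt_id)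
    (analyticOnNhd_dslope_exp z _)
  have h4 : (fun w => (z - w) * dslope Complex.exp z w) =
      fun w => Complex.exp z - Complex.exp w := by
    funext w
    have := sub_smul_dslope Complex.exp z w
    rw [smul_eq_mul] at this
    linear_combination -this
  rw [h4] at h3
  exact h1.unique h3

/-- One inclusion of the spectral mapping theorem: `e^σ(A) ⊆ σ(e^A)`. If `e^z - e^A` has the inverse
`R`, then `R g(A)` inverts `z - A`. -/
theorem IsRegularPoint.of_exp [BarrelledSpace ℂ X] {E : X →L[ℂ] X} {z : ℂ}
    (hA : SeminormBounded fun n : ℕ => A ^ n)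
    (hE : IsSeriesOf A (taylorCoeff Complex.exp) E)
    (h : IsRegularPoint (ofContinuous E) (Complex.exp z)) :
    IsRegularPoint (ofContinuous A) z := by
  rw [isRegularPoint_ofContinuous_iff] at *
  obtain ⟨R, hR1, hR2, hR⟩ := h
  have hg := summable_norm_taylorCoeff (analyticOnNhd_dslope_exp z (Metric.closedBall 0 1))
  obtain ⟨G, hG⟩ := exists_isSeriesOf hA hg
  have hfac := exp_smul_sub_eq_mul hA hE hG
  have hAE : Commute A (Complex.exp z • 1 - E) :=
    ((Commute.one_right A).smul_right _).sub_right (hE.commute (Commute.refl A))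
  have hRA : Commute R A := by
    change R * A = A * R
    calc R * A = R * (A * (Complex.exp z • 1 - E)) * R := by
          rw [mul_assoc, mul_assoc, hR2, mul_one]
      _ = A * R := by rw [hAE.eq, ← mul_assoc, hR1, one_mul]
  have hRG : Commute R G := hG.commute hRA
  have hAG : Commute (z • 1 - A) G :=
    ((Commute.one_left G).smul_left _).sub_left (hG.commute (Commute.refl A))
  refine ⟨R * G, ?_, ?_, hR.mul (hG.isAllanBounded hA hg) hRG⟩
  · rw [mul_assoc, ← hAG.eq, ← hfac, hR1]
  · rw [hRG.eq, ← mul_assoc, ← hfac, hR2]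

/-- The other inclusion of the spectral mapping theorem, `σ(e^A) ⊆ e^σ(A)`. The closed unit disc has
diameter less than `2π`, so `w ↦ c - e^w` has at most one zero `z` there. Without a zero, the
reciprocal function inverts `c - e^A`; with one, `e^z - e^w = (z - w) g(w)` with `g` free of zeros,
so that `c - e^A` is a product of two invertible operators. -/
theorem IsRegularPoint.exp [BarrelledSpace ℂ X] {E : X →L[ℂ] X} {c : ℂ}
    (hA : SeminormBounded fun n : ℕ => A ^ n)
    (hE : IsSeriesOf A (taylorCoeff Complex.exp) E)
    (h : ∀ z, Complex.exp z = c → IsRegularPoint (ofContinuous A) z) :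
    IsRegularPoint (ofContinuous E) c := by
  by_cases hz : ∃ z ∈ Metric.closedBall (0 : ℂ) 1, Complex.exp z = c
  · obtain ⟨z, hz1, rfl⟩ := hz
    obtain ⟨R, hR1, hR2, hR⟩ := isRegularPoint_ofContinuous_iff.1 (h z rfl)
    have hg := analyticOnNhd_dslope_exp z (Metric.closedBall 0 1)
    obtain ⟨G, hG⟩ := exists_isSeriesOf hA (summable_norm_taylorCoeff hg)
    have hfac := exp_smul_sub_eq_mul hA hE hG
    have hg0 : ∀ w ∈ Metric.closedBall (0 : ℂ) 1, dslope Complex.exp z w ≠ 0 := by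
      intro w hw h0
      have h1 := sub_smul_dslope Complex.exp z w
      rw [h0, smul_zero, eq_comm, sub_eq_zero] at h1
      obtain ⟨n, hn⟩ := Complex.exp_eq_exp_iff_exists_int.1 h1
      -- `w = z + 2πi n` with both points in the closed unit disc forces `n = 0`.
      have hn0 : n = 0 := by
        by_contra hne
        have h2 : ‖w - z‖ ≤ 2 := by
          rw [mem_closedBall_zero_iff] at hw hz1
          exact (norm_sub_le w z).trans (by linarith)
        have h3 : (1 : ℝ) ≤ |(n : ℝ)| := by exact_mod_cast Int.one_le_abs hne
        rw [hn, add_sub_cancel_left] at h2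
        simp [abs_of_pos Real.pi_pos] at h2
        nlinarith [Real.pi_gt_three]
      rw [hn0, Int.cast_zero, zero_mul, add_zero] at hn
      rw [hn, dslope_same, Complex.deriv_exp] at h0
      exact Complex.exp_ne_zero z h0
    obtain ⟨Q, hQs, hQ1, hQ2, hQ⟩ := exists_inverse_of_ne_zero hA hg hg0 hG
    have hRA : Commute R A := by
      have h1 : Commute R (z • 1 - A) := hR1.trans hR2.symm
      have h2 := ((Commute.one_right R).smul_right z).sub_right h1
      rwa [sub_sub_cancel] at h2
    have hRQ : Commute R Q := hQs.commute hRA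
    refine isRegularPoint_ofContinuous_iff.2 ⟨R * Q, ?_, ?_, hR.mul hQ hRQ⟩
    · have hAG : Commute (z • 1 - A) G :=
        ((Commute.one_left G).smul_left _).sub_left (hG.commute (Commute.refl A))
      rw [hfac, hAG.eq, mul_assoc, ← mul_assoc Q, hQ1, one_mul, hR1]
    · rw [hfac, hRQ.eq, mul_assoc, ← mul_assoc G, hQ2, one_mul, hR2]
  · have hexp := Complex.differentiable_exp.analyticAt (0 : ℂ)
    have hS := hE.const_sub c
    rw [← taylorCoeff_const_sub hexp] at hS
    obtain ⟨R, -, hR1, hR2, hR⟩ := exists_inverse_of_ne_zero hA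
      (fun w _ => analyticAt_const.sub (Complex.differentiable_exp.analyticAt w))
      (fun w hw h0 => hz ⟨w, hw, (sub_eq_zero.1 h0).symm⟩) hS
    exact isRegularPoint_ofContinuous_iff.2 ⟨R, hR1, hR2, hR⟩

/-- The spectral mapping theorem for `exp`, read off for suprema. -/
theorem spectralBound_eq_log_allanSpectralRadius [BarrelledSpace ℂ X] {A E : X →L[ℂ] X}
    (hA : SeminormBounded fun n : ℕ => A ^ n)
    (hE : IsSeriesOf A (taylorCoeff Complex.exp) E) :
    spectralBound (ofContinuous A) = ENNReal.log (allanSpectralRadius E) := by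
  have hlog (z : ℂ) : ENNReal.log (ENNReal.ofReal ‖Complex.exp z‖) = (z.re : EReal) := by
    rw [ENNReal.log_ofReal_of_pos (by simp), Complex.norm_exp, Real.log_exp]
  have hEb : IsAllanBounded E := hE.isAllanBounded hA (summable_norm_taylorCoeff
    (fun z _ => Complex.differentiable_exp.analyticAt z))
  apply le_antisymm
  · refine iSup₂_le fun z hz => ?_
    rw [← hlog z, ENNReal.log_le_log_iff]
    refine le_iSup₂_of_le (f := fun w _ => extendedModulus w) (Complex.exp z : OnePoint ℂ) ?_ le_rfl
    rw [coe_mem_allanSpectrum_iff] at hz ⊢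
    exact fun h => hz (h.of_exp hA hE)
  -- `log` is moved to the other side to have a supremum on the left.
  · rw [← EReal.log_exp (spectralBound _), ENNReal.log_le_log_iff]
    refine iSup₂_le fun w hw => ?_
    rw [← ENNReal.log_le_log_iff, EReal.log_exp]
    induction w using OnePoint.rec with
    | infty => exact absurd hw (infty_notMem_allanSpectrum hEb)
    | coe c =>
      rw [coe_mem_allanSpectrum_iff] at hw
      have h1 : ∃ z, Complex.exp z = c ∧ ¬ IsRegularPoint (ofContinuous A) z := by
        by_contra! h
        exact hw (.exp hA hE h)
      obtain ⟨z, rfl, hz⟩ := h1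
      change ENNReal.log (ENNReal.ofReal ‖Complex.exp z‖) ≤ _
      rw [hlog z]
      exact le_iSup₂_of_le (f := fun (z : ℂ) (_ : (z : OnePoint ℂ) ∈ allanSpectrum _) =>
        (z.re : EReal)) z (coe_mem_allanSpectrum_iff.2 hz) le_rfl

end Regular

/-! ### The semigroup as the exponential of its generator -/

/-- Taylor's formula for right derivatives: if every `u n` has the right derivative `u (n + 1)`, and
all `u n` are bounded by `C` on `[0, 1]`, the `N`-th Taylor polynomial of `u n` is within
`C t ^ N / N!` of `u n t`. -/
theorem norm_sub_taylor_le {u : ℕ → ℝ → ℂ} {C : ℝ}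
    (hcont : ∀ n, ContinuousOn (u n) (Set.Icc 0 1))
    (hderiv : ∀ n, ∀ t ∈ Set.Ico (0 : ℝ) 1, HasDerivWithinAt (u n) (u (n + 1) t) (Set.Ici t) t)
    (hC : ∀ n, ∀ t ∈ Set.Icc (0 : ℝ) 1, ‖u n t‖ ≤ C) (N n : ℕ) :
    ∀ t ∈ Set.Icc (0 : ℝ) 1,
      ‖u n t - ∑ k ∈ Finset.range N, ((t ^ k / k.factorial : ℝ) : ℂ) * u (n + k) 0‖ ≤
        C * (t ^ N / N.factorial) := by
  have hpow (k : ℕ) (t : ℝ) : HasDerivAt (fun t : ℝ => t ^ (k + 1) / (k + 1).factorial)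
      (t ^ k / k.factorial) t := by
    refine ((hasDerivAt_pow (k + 1) t).div_const _).congr_deriv ?_
    rw [Nat.factorial_succ]
    push_cast
    field_simp
  induction N generalizing n with
  | zero => simpa using hC n
  | succ N ih =>
    refine image_norm_le_of_norm_deriv_right_le_deriv_boundary
      (f' := fun t => u (n + 1) t -
        ∑ k ∈ Finset.range N, ((t ^ k / k.factorial : ℝ) : ℂ) * u (n + 1 + k) 0)
      (B' := fun t => C * (t ^ N / N.factorial)) ?_ (fun t ht => ?_) ?_
      (fun t => (hpow N t).const_mul C) (fun t ht => ih (n + 1) t ⟨ht.1, ht.2.le⟩)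
    · exact (hcont n).sub (by fun_prop)
    · refine (hderiv n t ht).sub ?_
      simp only [Finset.sum_range_succ' _ N]
      have h1 : HasDerivAt (fun t : ℝ => ∑ k ∈ Finset.range N,
          ((t ^ (k + 1) / (k + 1).factorial : ℝ) : ℂ) * u (n + (k + 1)) 0)
          (∑ k ∈ Finset.range N, ((t ^ k / k.factorial : ℝ) : ℂ) * u (n + 1 + k) 0) t := by
        refine HasDerivAt.fun_sum fun k _ => ?_
        rw [show n + 1 + k = n + (k + 1) by ring]
        exact ((hpow k t).ofReal_comp).mul_const _
      simpa using! (h1.add_const (u n 0)).hasDerivWithinAt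
    · simp [Finset.sum_range_succ']

/-- The derivative at `0` propagates along the orbit by the semigroup law, but only as a right
derivative; it is tested against continuous functionals. -/
theorem IsC0Semigroup.hasDerivWithinAt {X : Type*} [AddCommGroup X] [Module ℂ X]
    [UniformSpace X] {T : ℝ≥0 → X →L[ℂ] X} (hT : IsC0Semigroup T) {x y : X}
    (hx : HasGeneratorValue T x y) (f : X →L[ℂ] ℂ) {t : ℝ} (ht : 0 ≤ t) :
    HasDerivWithinAt (fun s : ℝ => f (T s.toNNReal x)) (f (T t.toNNReal y)) (Set.Ici t) t := by
  rw [hasDerivWithinAt_iff_tendsto_slope, Set.Ici_sdiff_left]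
  have h1 : Tendsto (fun s : ℝ => (s - t).toNNReal) (𝓝[>] t) (𝓝[>] 0) := by
    refine tendsto_nhdsWithin_iff.2 ⟨?_, ?_⟩
    · have : Continuous fun s : ℝ => (s - t).toNNReal := by fun_prop
      simpa using (this.tendsto t).mono_left nhdsWithin_le_nhds
    · filter_upwards [self_mem_nhdsWithin] with s hs
      simpa using hs
  have h2 := (((f.comp (T t.toNNReal)).continuous.tendsto y).comp hx).comp h1
  refine h2.congr' ?_
  filter_upwards [self_mem_nhdsWithin] with s hs
  have hs' : 0 ≤ s - t := sub_nonneg.2 (le_of_lt hs)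
  have h3 : s.toNNReal = t.toNNReal + (s - t).toNNReal := by
    rw [← Real.toNNReal_add ht hs', add_sub_cancel]
  simp [slope_def_module, h3, hT.map_add, Real.coe_toNNReal _ hs']

section Semigroup

variable {X : Type*} [AddCommGroup X] [Module ℂ X] [UniformSpace X] [IsUniformAddGroup X]
  [ContinuousSMul ℂ X]

theorem hasGeneratorValue_of_generator_eq [T2Space X] {T : ℝ≥0 → X →L[ℂ] X} {A : X →L[ℂ] X}
    (hA : generator T = ofContinuous A) (x : X) : HasGeneratorValue T x (A x) := by
  have hx : x ∈ (generator T).domain := by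
    rw [hA]
    trivial
  have hval : ∀ (B : X →ₗ.[ℂ] X) (hx : x ∈ B.domain), B = ofContinuous A → B ⟨x, hx⟩ = A x := by
    rintro _ _ rfl
    rfl
  have h1 : generator T ⟨x, hx⟩ = A x := hval _ hx hA
  rw [← h1]
  exact hx.choose_spec

/-- An exponentially equicontinuous semigroup whose generator is everywhere defined and has
equicontinuous powers is given at time one by the exponential series of its generator. -/
theorem isSeriesOf_exp [PolynormableSpace ℂ X] [LocallyConvexSpace ℝ X] [T2Space X]
    [CompleteSpace X]
    {T : ℝ≥0 → X →L[ℂ] X} (hT : IsC0Semigroup T) (hexp : IsExpEquicontinuous T) {A : X →L[ℂ] X}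
    (hA : generator T = ofContinuous A) (hpow : SeminormBounded fun n : ℕ => A ^ n) :
    IsSeriesOf A (taylorCoeff Complex.exp) (T 1) := by
  obtain ⟨E, hE⟩ := exists_isSeriesOf hpow (summable_norm_taylorCoeff
    (fun z _ => Complex.differentiable_exp.analyticAt z))
  -- The orbits take values in a space without a norm, so Taylor's formula is applied to
  -- `t ↦ f (T(t) Aⁿ x)`, with `f` a functional that would separate `T(1) x` from the series.
  suffices h : T 1 = E by rwa [h]
  refine ContinuousLinearMap.ext fun x => ?_
  by_contra hne
  obtain ⟨f, hf⟩ := RCLike.geometric_hahn_banach_point_point (𝕜 := ℂ) hne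
  suffices h : f (T 1 x) = f (E x) by simp [h] at hf
  obtain ⟨ω, hω⟩ := hexp
  obtain ⟨p, hpc, M, hM1, hM⟩ := hω ((normSeminorm ℂ ℂ).comp (f : X →ₗ[ℂ] ℂ)) f.continuous.norm
  obtain ⟨q, -, hq⟩ := hpow p hpc
  have hbound (n : ℕ) (t : ℝ) (ht : t ∈ Set.Icc (0 : ℝ) 1) :
      ‖f (T t.toNNReal ((A ^ n) x))‖ ≤ M * Real.exp |ω| * q x := by
    refine (hM t.toNNReal ((A ^ n) x)).trans ?_
    have h1 : ω * (t.toNNReal : ℝ) ≤ |ω| := by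
      rw [Real.coe_toNNReal _ ht.1]
      exact (mul_le_mul_of_nonneg_right (le_abs_self ω) ht.1).trans
        (mul_le_of_le_one_right (abs_nonneg ω) ht.2)
    have := hq n x
    have hp0 := apply_nonneg p ((A ^ n) x)
    gcongr
  have htaylor (N : ℕ) := norm_sub_taylor_le (u := fun n t => f (T t.toNNReal ((A ^ n) x)))
    (fun n => (f.continuous.comp
      ((hT.continuous_orbit _).comp continuous_real_toNNReal)).continuousOn)
    (fun n t ht => by
      have h1 := hT.hasDerivWithinAt (hasGeneratorValue_of_generator_eq hA ((A ^ n) x)) f ht.1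
      rw [pow_succ']
      exact h1) hbound N 0 1 (by simp)
  have hlim : Tendsto (fun N : ℕ => ∑ k ∈ Finset.range N,
      (((1 : ℝ) ^ k / k.factorial : ℝ) : ℂ) * f (T (0 : ℝ).toNNReal ((A ^ (0 + k)) x)))
      atTop (𝓝 (f (T 1 x))) := by
    rw [tendsto_iff_norm_sub_tendsto_zero]
    have h0 : Tendsto (fun N : ℕ => M * Real.exp |ω| * q x * ((1 : ℝ) ^ N / N.factorial)) atTop
        (𝓝 0) := by
      simpa using (FloorSemiring.tendsto_pow_div_factorial_atTop (1 : ℝ)).const_mul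
        (M * Real.exp |ω| * q x)
    refine squeeze_zero (fun _ => norm_nonneg _) (fun N => ?_) h0
    rw [norm_sub_rev]
    simpa using htaylor N
  refine tendsto_nhds_unique hlim ?_
  refine (f.hasSum (hE x)).tendsto_sum_nat.congr fun N => Finset.sum_congr rfl fun k _ => ?_
  simp [taylorCoeff_exp, hT.map_zero]

end Semigroup

end FrechetSemigroup

theorem mainTheorem3 {X : Type*} [AddCommGroup X] [Module ℂ X] [UniformSpace X]
    [IsUniformAddGroup X] [ContinuousSMul ℂ X] [LocallyConvexSpace ℝ X]
    [TopologicalSpace.MetrizableSpace X] [CompleteSpace X]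
    (T : ℝ≥0 → X →L[ℂ] X)
    (hT : FrechetSemigroup.IsC0Semigroup T)
    (hexp : FrechetSemigroup.IsExpEquicontinuous T)
    (A : X →L[ℂ] X)
    (hA : FrechetSemigroup.generator T = FrechetSemigroup.ofContinuous A)
    (hpow : Equicontinuous fun (n : ℕ) (x : X) => (A ^ n) x) :
    FrechetSemigroup.spectralBound (FrechetSemigroup.generator T) =
      ENNReal.log (FrechetSemigroup.allanSpectralRadius (T 1)) := by
  have hpoly : PolynormableSpace ℂ X :=
    FrechetSemigroup.polynormableSpace_of_locallyConvexSpace_real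
  -- A metrizable uniform group has a countably generated uniformity, so `X` is a Baire space.
  have : (uniformity X).IsCountablyGenerated := IsUniformAddGroup.uniformity_countably_generated
  have hbar : BarrelledSpace ℂ X := inferInstance
  have hbd := FrechetSemigroup.equicontinuous_iff_seminormBounded.1 hpow
  rw [hA]
  exact FrechetSemigroup.spectralBound_eq_log_allanSpectralRadius hbd
    (FrechetSemigroup.isSeriesOf_exp hT hexp hA hbd)
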